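/- **Setting.** An episodic MDP is $M=(\mathcal S,\mathcal A,R,P,\mu_0,H)$ with finite state space of size $S$, finite action space of size $A$, reward function $R$, transition probabilities $P(s'\mid s,a)$, initial state distribution $\mu_0$ and episode length $H\ge 1$. Its minimum transition probability is $p_{\min}=\min\{P(s'\mid s,a): P(s'\mid s,a)>0\}$. Its diameter $D$ is the maximum over states $s$ of the smallest $T$ for which there is a path $s_0,a_0,s_1,\dots,s_T=s$ with $\mu_0(s_0)>0$ and $P(s_{t+1}\mid s_t,a_t)>0$ for all $t<T$ ($D=\infty$ if some state is unreachable). A learner with exploration probability $\epsilon\in[0,1]$ keeps a Q-table $Q_t\in\mathbb R^{\mathcal S\times\mathcal A}$. In state $s$ it plays an action $a^*\in\arg\max_a Q_t(s,a)$ (ties broken, possibly at random, by any rule depending on $Q_t$ and $s$) with probability $1-\epsilon$, and a uniformly random action other than $a^*$ with probability $\epsilon$. After the experience $e_t=(s_t,a_t,r_t,s_{t+1})$ it sets $Q_{t+1}=f(Q_t,e_t)$, which changes at most the entry $(s_t,a_t)$; moreover, for every $Q_t,s_t,a_t,s_{t+1}$ there are rewards $r_t$ that make $a_t$ the unique best action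 in $Q_{t+1}(s_t,\cdot)$, that make it the unique worst one, and that leave its rank unchanged, respectively. The learner is greedy if $\epsilon=0$. A Level 4 teacher chooses only the rewards: $r_t$ may depend on the entire history and on $(s_t,a_t,s_{t+1})$, while actions are chosen by the learner, $s_{t+1}\sim P(\cdot\mid s_t,a_t)$, and the state is drawn afresh from $\mu_0$ at the start of each episode of $H$ steps. For a target policy $\pi^\dagger:\mathcal S\to\mathcal A$ let $T$ be the first $t$ such that $\arg\max_a Q_t(s,a)=\{\pi^\dagger(s)\}$ for all $s$. Let $\mathrm{METaL}(M,L,Q_0,\pi^\dagger)$ be the infimum of $\mathbb E[T]$ over all Level 4 teachers, and for a family $\mathcal M$ of MDPs on $\mathcal S,\mathcal A$ let $\mathrm{TDim}=\sup_{\pi^\dagger,\,Q_0,\,M\in\mathcal M}\mathrm{METaL}(M,L,Q_0,\pi^\dagger)$. **Corollary.** There is a universal constant $C$ such that the following holds. Let $L$ be a greedy learner ($\epsilon=0$), and let $\mathcal M$ be a family of MDPs with $|\mathcal S|=S$, $|\mathcal A|=A$, episode length $H$, diameter $D<H$ and minimum transition probability $p_{\min}$, in each of which every episode starts in a fixed initial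 state ($\mu_0$ is a point mass, at a state that may depend on the MDP). Then the Level 4 teaching dimension satisfies $$\mathrm{TDim}\;\le\; C\,S\,A\,H\left(\frac1{p_{\min}}\right)^{D}.$$ -/

import Mathlib

open MeasureTheory ProbabilityTheory
open scoped ENNReal NNReal

noncomputable section

namespace TeachRL

universe u v

/-- An episodic Markov decision process `(S, A, R, P, μ₀, H)` with state space `S` and action
space `A`; `P s a s'` is the probability of moving to `s'` after taking `a` in `s`. -/
structure MDP (S : Type u) (A : Type v) where
  /-- environment reward -/
  R : S → A → ℝ
  /-- transition probabilities -/
  P : S → A → PMF S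
  /-- initial state distribution -/
  init : PMF S
  /-- episode length `H` -/
  horizon : ℕ
  horizon_pos : 0 < horizon

/-- The state `s` is the end point of a path with `T` edges in the transition graph of `M`
that starts at a possible initial state. -/
def MDP.ReachableIn {S : Type u} {A : Type v} (M : MDP S A) (T : ℕ) (s : S) : Prop :=
  ∃ (x : ℕ → S) (a : ℕ → A), 0 < M.init (x 0) ∧ (∀ t < T, 0 < M.P (x t) (a t) (x (t + 1))) ∧
    x T = s

/-- The diameter: the maximum over states of the length of a shortest path to the state
(it is `⊤` when some state cannot be reached). -/
def MDP.diameter {S : Type u} {A : Type v} (M : MDP S A) : ℕ∞ :=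
  ⨆ s : S, ⨅ (T : ℕ) (_ : M.ReachableIn T s), (T : ℕ∞)

/-- The minimum transition probability: the minimum of the positive values of `P`. -/
def MDP.pMin {S : Type u} {A : Type v} (M : MDP S A) : ℝ≥0∞ :=
  ⨅ (s : S) (a : A) (s' : S) (_ : 0 < M.P s a s'), M.P s a s'

/-- The family of Q-learning agents. A Q-table is a function `Q : S → A → ℝ`.

* `eps` is the exploration probability and `greedy Q s` the law of the greedy action `a*` in
  state `s`, which is always a maximiser of `Q s`; how ties are broken is left to the agent.
* `update Q s a r s'` is the Q-table after the experience `(s, a, r, s')`. It only modifies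
  the entry `(s, a)`, and a reward can be chosen so that `a` becomes the unique best action
  of `s`, the unique worst one, or keeps its rank. -/
structure QLearner (S : Type u) (A : Type v) where
  eps : ℝ≥0
  eps_le_one : eps ≤ 1
  greedy : (S → A → ℝ) → S → PMF A
  greedy_isMax : ∀ Q s, ∀ a ∈ (greedy Q s).support, ∀ b, Q s b ≤ Q s a
  update : (S → A → ℝ) → S → A → ℝ → S → (S → A → ℝ)
  update_eq_of_ne : ∀ Q s a r s' x b, (x, b) ≠ (s, a) → update Q s a r s' x b = Q x b
  exists_first : ∀ Q s a s', ∃ r, ∀ b, b ≠ a → update Q s a r s' s b < update Q s a r s' s a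
  exists_last : ∀ Q s a s', ∃ r, ∀ b, b ≠ a → update Q s a r s' s a < update Q s a r s' s b
  exists_unchanged : ∀ Q s a s', ∃ r, ∀ b,
    (update Q s a r s' s b < update Q s a r s' s a ↔ Q s b < Q s a) ∧
      (update Q s a r s' s a < update Q s a r s' s b ↔ Q s a < Q s b)

/-- A coin that shows `true` with probability `p`. -/
def coin (p : ℝ≥0) (hp : p ≤ 1) : PMF Bool :=
  PMF.ofFintype (fun b => cond b (p : ℝ≥0∞) (1 - p)) (by simp [hp])

open scoped Classical in
/-- The uniform law on the actions other than `a` (the point mass at `a` if there are none). -/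
def uniformOther {A : Type v} [Fintype A] (a : A) : PMF A :=
  if h : (Finset.univ.erase a).Nonempty then PMF.uniformOfFinset (Finset.univ.erase a) h
  else PMF.pure a

/-- The `ε`-greedy behaviour policy: the greedy action `a*` with probability `1 - ε`, a uniform
action different from `a*` with probability `ε`. -/
def QLearner.behavior {S : Type u} {A : Type v} [Fintype A] (L : QLearner S A)
    (Q : S → A → ℝ) (s : S) : PMF A :=
  (L.greedy Q s).bind fun a =>
    (coin L.eps L.eps_le_one).bind fun explore =>
      if explore = true then uniformOther a else PMF.pure a

/-- The part `(s_t, a_t, s_{t+1})` of the experience that the teacher does not control. -/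
@[ext] structure Step (S : Type u) (A : Type v) where
  state : S
  action : A
  next : S

instance {S : Type u} {A : Type v} : MeasurableSpace (Step S A) := ⊤

instance {S : Type u} {A : Type v} : DiscreteMeasurableSpace (Step S A) := ⟨fun _ => trivial⟩

instance {S : Type u} {A : Type v} [Finite S] [Finite A] : Finite (Step S A) :=
  Finite.of_injective (fun e => (e.state, e.action, e.next)) (by
    rintro ⟨s, a, s'⟩ ⟨x, b, x'⟩ h
    simpa using h)

/-- A level 4 teacher only chooses rewards: from the history (most recent step first) and the
current `(s_t, a_t, s_{t+1})` it computes the reward `r_t`. -/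
abbrev Teacher (S : Type u) (A : Type v) := List (Step S A) → Step S A → ℝ

/-- The Q-table after a history (most recent step first). -/
def qTable {S : Type u} {A : Type v} (L : QLearner S A) (τ : Teacher S A) (Q₀ : S → A → ℝ) :
    List (Step S A) → (S → A → ℝ)
  | [] => Q₀
  | e :: h => L.update (qTable L τ Q₀ h) e.state e.action (τ h e) e.next

/-- The law of the current state after a history (most recent step first): the state is drawn
from the initial distribution at the start of each episode, every `H` steps. -/
def stateLaw {S : Type u} {A : Type v} (M : MDP S A) : List (Step S A) → PMF S
  | [] => M.init
  | e :: h => if M.horizon ∣ (e :: h).length then M.init else PMF.pure e.next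

/-- The law of the next step after a history, with next states drawn from `P`. -/
def stepLaw {S : Type u} {A : Type v} [Fintype A] (M : MDP S A) (L : QLearner S A)
    (τ : Teacher S A) (Q₀ : S → A → ℝ) (h : List (Step S A)) : PMF (Step S A) :=
  (stateLaw M h).bind fun s =>
    (L.behavior (qTable L τ Q₀ h) s).bind fun a =>
      (M.P s a).map fun s' => ⟨s, a, s'⟩

/-- The history of the first `n` steps of a trajectory (most recent step first). -/
def history {S : Type u} {A : Type v} (ω : ℕ → Step S A) : ℕ → List (Step S A)
  | 0 => []
  | n + 1 => ω n :: history ω n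

/-- The history recorded by the steps `0, …, n` (most recent step first). -/
def historyOf {S : Type u} {A : Type v} (n : ℕ) (x : (i : Finset.Iic n) → Step S A) :
    List (Step S A) :=
  (List.ofFn fun i : Fin (n + 1) => x ⟨i, Finset.mem_Iic.2 (Nat.le_of_lt_succ i.2)⟩).reverse

/-- The transition kernel from the steps `0, …, n` to step `n + 1`. -/
def stepKernel {S : Type u} {A : Type v} [Fintype S] [Fintype A] (M : MDP S A)
    (L : QLearner S A) (τ : Teacher S A) (Q₀ : S → A → ℝ) (n : ℕ) :
    Kernel ((_ : Finset.Iic n) → Step S A) (Step S A) :=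
  Kernel.ofFunOfCountable fun x => (stepLaw M L τ Q₀ (historyOf n x)).toMeasure

instance {S : Type u} {A : Type v} [Fintype S] [Fintype A] (M : MDP S A)
    (L : QLearner S A) (τ : Teacher S A) (Q₀ : S → A → ℝ) (n : ℕ) :
    IsMarkovKernel (stepKernel M L τ Q₀ n) :=
  ⟨fun x => PMF.toMeasure.isProbabilityMeasure (stepLaw M L τ Q₀ (historyOf n x))⟩

/-- The law of the infinite trajectory of the teaching process. -/
def trajectoryLaw {S : Type u} {A : Type v} [Fintype S] [Fintype A] (M : MDP S A)
    (L : QLearner S A) (τ : Teacher S A) (Q₀ : S → A → ℝ) : Measure (ℕ → Step S A) :=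
  Kernel.trajMeasure (X := fun _ => Step S A) (stepLaw M L τ Q₀ []).toMeasure
    (stepKernel M L τ Q₀)

/-- The greedy policy of the Q-table `Q` is unambiguously `π`: `argmax_a Q s a = {π s}`. -/
def Induces {S : Type u} {A : Type v} (Q : S → A → ℝ) (π : S → A) : Prop :=
  ∀ s a, a ≠ π s → Q s a < Q s (π s)

/-- The number of steps until the target policy `π` is learned (`⊤` if this never happens). -/
def teachingTime {S : Type u} {A : Type v} (L : QLearner S A) (τ : Teacher S A)
    (Q₀ : S → A → ℝ) (π : S → A) (ω : ℕ → Step S A) : ℝ≥0∞ :=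
  ⨅ (n : ℕ) (_ : Induces (qTable L τ Q₀ (history ω n)) π), (n : ℝ≥0∞)

/-- The minimum expected teaching length over all level 4 teachers. -/
def metal {S : Type u} {A : Type v} [Fintype S] [Fintype A] (M : MDP S A)
    (L : QLearner S A) (Q₀ : S → A → ℝ) (π : S → A) : ℝ≥0∞ :=
  ⨅ τ : Teacher S A, ∫⁻ ω, teachingTime L τ Q₀ π ω ∂(trajectoryLaw M L τ Q₀)

/-- The level 4 teaching dimension of the learner `L` with respect to a family of MDPs. -/
def teachingDim {S : Type u} {A : Type v} [Fintype S] [Fintype A] (L : QLearner S A)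
    (F : Set (MDP S A)) : ℝ≥0∞ :=
  ⨆ (π : S → A) (Q₀ : S → A → ℝ) (M ∈ F), metal M L Q₀ π

end TeachRL

end

/-!
The teacher traverses a spanning tree of shortest paths of the transition graph (`NavTree`) depth
first. At every moment the learner is taught one action in one state, the current state `cur` of
the `Plan`: if `cur` has a child that is not done yet, the action that leads to it, and then the
child becomes the current state; otherwise the target action, and then `cur` is done and the
traversal returns to its parent. Hence the Q-table always points from the root down to the current
state (`Plan.Valid`, `valid_planAfter`), and there are at most two lessons for each state, one to
point its parent at it and one for its target action. A depth-first order is essential here: going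
through the states level by level would re-teach the upper part of the tree again and again.

A lesson takes at most `|A|` visits to the current state, since the teacher demotes each greedy
action other than the wanted one to the last place, and promotes the wanted one when it is played.
So a potential of size `O(|S| |A|)` drops at each visit (`potential_lt_of_isLesson`). All rewards
outside of the current state leave the ranking of the actions alone, so that nothing taught
is lost.

As every episode starts at the root and the current state has depth at most `D < H`, a greedy
learner visits it in each episode with probability at least `pMin ^ D`, so a visit costs at most
`B = H (1 / pMin) ^ D` steps on average. This is made precise by a Lyapunov function on histories
(`lyapunov`): it is the potential times `B` plus the number of steps left in the episode, minus
`pMin ^ k * B` while the learner is on the path at distance `k` from the current state. It drops by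
at least one in each step in expectation (`one_add_tsum_lyapunov_le`), which bounds the expected
teaching time by its initial value (`lintegral_teachingTime_le`).
-/

noncomputable section

namespace TeachRL

universe u v

variable {S : Type u} {A : Type v}

section

/-! ### Integrals along the teaching process -/

lemma historyOf_frestrictLe (n : ℕ) (ω : ℕ → Step S A) :
    historyOf n (Preorder.frestrictLe n ω) = history ω (n + 1) := by
  have key : ∀ m : ℕ, (List.ofFn fun i : Fin m => ω i).reverse = history ω m := by
    intro m
    induction m with
    | zero => rfl
    | succ m ih =>
      rw [List.ofFn_succ', List.concat_eq_append, List.reverse_append]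
      simp only [history]
      rw [← ih]
      rfl
  exact key (n + 1)

variable [Fintype S] [Fintype A]

lemma measurable_comp_history (g : List (Step S A) → ℝ≥0∞) (n : ℕ) :
    Measurable fun ω : ℕ → Step S A => g (history ω n) := by
  cases n with
  | zero => exact measurable_const (a := g [])
  | succ n =>
    have h : Measurable fun x : (i : Finset.Iic n) → Step S A => g (historyOf n x) :=
      measurable_of_countable _
    have := h.comp (Preorder.measurable_frestrictLe (X := fun _ => Step S A) n)
    simpa only [Function.comp_def, historyOf_frestrictLe] using this

lemma lintegral_pmf (μ : PMF (Step S A)) (f : Step S A → ℝ≥0∞) :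
    ∫⁻ e, f e ∂μ.toMeasure = ∑' e, μ e * f e := by
  rw [lintegral_countable']
  refine tsum_congr fun e => ?_
  rw [PMF.toMeasure_apply_singleton _ _ (measurableSet_singleton _), mul_comm]

variable (M : MDP S A) (L : QLearner S A) (τ : Teacher S A) (Q₀ : S → A → ℝ)

instance : IsProbabilityMeasure (trajectoryLaw M L τ Q₀) := by
  unfold trajectoryLaw
  infer_instance

lemma map_trajectoryLaw_zero :
    (trajectoryLaw M L τ Q₀).map (fun ω => ω 0) = (stepLaw M L τ Q₀ []).toMeasure := by
  have h : (fun ω : ℕ → Step S A => ω 0) =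
      (fun x : (i : Finset.Iic 0) → Step S A => x ⟨0, Finset.mem_Iic.2 le_rfl⟩) ∘
        Preorder.frestrictLe (π := fun _ => Step S A) 0 := rfl
  rw [h, ← Measure.map_map (by fun_prop)
      (Preorder.measurable_frestrictLe (X := fun _ => Step S A) 0), trajectoryLaw,
    Kernel.trajMeasure, Measure.map_comp _ _
      (Preorder.measurable_frestrictLe (X := fun _ => Step S A) 0),
    Kernel.traj_map_frestrictLe, Kernel.partialTraj_self, Measure.id_comp,
    Measure.map_map (by fun_prop) (by fun_prop)]
  exact Measure.map_id

/-- The Markov property of the teaching process: given the first `n` steps, the next step has law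
`stepLaw`. -/
lemma lintegral_history_succ (g : List (Step S A) → ℝ≥0∞) (n : ℕ) :
    ∫⁻ ω, g (history ω (n + 1)) ∂trajectoryLaw M L τ Q₀ =
      ∫⁻ ω, ∑' e, stepLaw M L τ Q₀ (history ω n) e * g (e :: history ω n)
        ∂trajectoryLaw M L τ Q₀ := by
  cases n with
  | zero =>
    have h0 := map_trajectoryLaw_zero M L τ Q₀
    simp only [history, lintegral_const, measure_univ, mul_one]
    rw [← lintegral_pmf, ← h0, lintegral_map (measurable_of_countable _) (measurable_pi_apply 0)]
  | succ n =>
    have key := Kernel.map_frestrictLe_trajMeasure_compProd_eq_map_trajMeasure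
      (X := fun _ => Step S A) (μ₀ := (stepLaw M L τ Q₀ []).toMeasure)
      (κ := stepKernel M L τ Q₀) (a := n)
    have h2 := congrArg (fun ν => ∫⁻ z, g (z.2 :: historyOf n z.1) ∂ν) key
    rw [Measure.lintegral_compProd (measurable_of_countable _),
      lintegral_map (measurable_of_countable _) (by fun_prop),
      lintegral_map (measurable_of_countable _) (by fun_prop)] at h2
    simp only [historyOf_frestrictLe] at h2
    rw [show (fun ω : ℕ → Step S A => g (history ω (n + 1 + 1))) =
      fun ω => g (ω (n + 1) :: history ω (n + 1)) from rfl]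
    refine h2.symm.trans (lintegral_congr fun ω => ?_)
    rw [← lintegral_pmf]
    rw [← historyOf_frestrictLe]
    rfl

/-- A Lyapunov bound on the teaching time: if, as long as the target policy is not learned, the
expected value of `W` drops by at least one in every step, then the expected teaching time is at
most the initial value of `W`. -/
lemma lintegral_teachingTime_le (π : S → A) (W : List (Step S A) → ℝ≥0∞)
    (hW : ∀ h, ¬ Induces (qTable L τ Q₀ h) π →
      1 + ∑' e, stepLaw M L τ Q₀ h e * W (e :: h) ≤ W h) :
    ∫⁻ ω, teachingTime L τ Q₀ π ω ∂trajectoryLaw M L τ Q₀ ≤ W [] := by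
  classical
  -- `run h` says that the target was not learned at any time recorded by the history `h`
  let run : List (Step S A) → Prop := fun h => ∀ k, ¬ Induces (qTable L τ Q₀ (h.drop k)) π
  have run_tail : ∀ e h, run (e :: h) → run h := fun e h hr k => by simpa using hr (k + 1)
  have run_head : ∀ h, run h → ¬ Induces (qTable L τ Q₀ h) π := fun h hr => by simpa using hr 0
  -- the teaching time is at most the number of times `n` with `one (history ω n) = 1`, and `V` is
  -- `W` set to zero once the target is learned
  let one : List (Step S A) → ℝ≥0∞ := fun h => if run h then 1 else 0
  let V : List (Step S A) → ℝ≥0∞ := fun h => if run h then W h else 0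
  set ν := trajectoryLaw M L τ Q₀
  have step : ∀ n, ∫⁻ ω, one (history ω n) ∂ν + ∫⁻ ω, V (history ω (n + 1)) ∂ν ≤
      ∫⁻ ω, V (history ω n) ∂ν := by
    intro n
    rw [lintegral_history_succ, ← lintegral_add_left (measurable_comp_history one n)]
    refine lintegral_mono fun ω => ?_
    simp only [one, V]
    by_cases hr : run (history ω n)
    · rw [if_pos hr, if_pos hr]
      refine le_trans ?_ (hW _ (run_head _ hr))
      gcongr
      split_ifs <;> simp
    · have h0 : ∀ e, ¬ run (e :: history ω n) := fun e he => hr (run_tail _ _ he)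
      simp [hr, h0]
  have partial_sum : ∀ n, ∑ i ∈ Finset.range n, ∫⁻ ω, one (history ω i) ∂ν +
      ∫⁻ ω, V (history ω n) ∂ν ≤ W [] := by
    intro n
    induction n with
    | zero =>
      simp only [Finset.range_zero, Finset.sum_empty, zero_add, history, lintegral_const,
        measure_univ, mul_one, V]
      split_ifs <;> simp
    | succ n ih =>
      rw [Finset.sum_range_succ, add_assoc]
      exact le_trans (by gcongr; exact step n) ih
  have time_le : ∀ ω, teachingTime L τ Q₀ π ω ≤ ∑' n, one (history ω n) := by
    intro ω
    have drop_history : ∀ n k, ∃ j ≤ n, (history ω n).drop k = history ω j := by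
      intro n
      induction n with
      | zero => exact fun k => ⟨0, le_rfl, by simp [history]⟩
      | succ n ih =>
        intro k
        cases k with
        | zero => exact ⟨n + 1, le_rfl, rfl⟩
        | succ k =>
          obtain ⟨j, hj, h⟩ := ih k
          exact ⟨j, hj.trans n.le_succ, by simpa [history] using h⟩
    by_cases hl : ∃ n, Induces (qTable L τ Q₀ (history ω n)) π
    · have hrun : ∀ i ∈ Finset.range (Nat.find hl), one (history ω i) = 1 := by
        intro i hi
        refine if_pos fun k => ?_
        obtain ⟨j, hj, h⟩ := drop_history i k
        rw [h]
        exact Nat.find_min hl (hj.trans_lt (Finset.mem_range.1 hi))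
      calc teachingTime L τ Q₀ π ω ≤ (Nat.find hl : ℝ≥0∞) :=
            iInf₂_le (Nat.find hl) (Nat.find_spec hl)
        _ = ∑ i ∈ Finset.range (Nat.find hl), one (history ω i) := by
          rw [Finset.sum_congr rfl hrun]; simp
        _ ≤ _ := ENNReal.sum_le_tsum _
    · have hrun : ∀ i, one (history ω i) = 1 := by
        intro i
        refine if_pos fun k => ?_
        obtain ⟨j, -, h⟩ := drop_history i k
        rw [h]
        exact fun hI => hl ⟨j, hI⟩
      simp [hrun]
  calc ∫⁻ ω, teachingTime L τ Q₀ π ω ∂ν ≤ ∫⁻ ω, ∑' n, one (history ω n) ∂ν :=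
        lintegral_mono time_le
    _ = ∑' n, ∫⁻ ω, one (history ω n) ∂ν :=
      lintegral_tsum fun n => (measurable_comp_history one n).aemeasurable
    _ ≤ W [] := by
      rw [ENNReal.tsum_eq_iSup_nat]
      exact iSup_le fun n => le_self_add.trans (partial_sum n)

end

section

/-! ### Navigation trees -/

/-- A spanning tree of the transition graph of `M`, rooted at `s₀`: every state `v` other than the
root has a parent `par v`, from which the action `nav v` leads to `v` with positive
probability. -/
structure NavTree (M : MDP S A) (s₀ : S) where
  par : S → S
  nav : S → A
  depth : S → ℕ
  par_root : par s₀ = s₀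
  depth_root : depth s₀ = 0
  depth_eq : ∀ v, v ≠ s₀ → depth v = depth (par v) + 1
  pos : ∀ v, v ≠ s₀ → 0 < M.P (par v) (nav v) v

/-- The tree of shortest paths; its height is at most the diameter. -/
lemma exists_navTree [Nonempty A] {M : MDP S A} {s₀ : S} (h₀ : M.init = PMF.pure s₀) {D : ℕ}
    (hD : M.diameter = D) : ∃ T : NavTree M s₀, ∀ v, T.depth v ≤ D := by
  classical
  have hreach : ∀ v, ∃ T ≤ D, M.ReachableIn T v := by
    intro v
    have h1 : (⨅ (T : ℕ) (_ : M.ReachableIn T v), (T : ℕ∞)) < ((D + 1 : ℕ) : ℕ∞) := by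
      refine lt_of_le_of_lt (le_iSup (fun s => ⨅ (T : ℕ) (_ : M.ReachableIn T s), (T : ℕ∞)) v) ?_
      rw [← MDP.diameter, hD]
      exact_mod_cast D.lt_succ_self
    simp only [iInf_lt_iff] at h1
    obtain ⟨T, hT, hlt⟩ := h1
    exact ⟨T, Nat.lt_succ_iff.1 (by exact_mod_cast hlt), hT⟩
  have hex : ∀ v, ∃ T, M.ReachableIn T v := fun v => (hreach v).imp fun _ h => h.2
  have hinit : ∀ x, 0 < M.init x → x = s₀ := by
    intro x hx
    rw [h₀, PMF.pure_apply] at hx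
    by_contra hne
    simp [hne] at hx
  have hroot : M.ReachableIn 0 s₀ :=
    ⟨fun _ => s₀, fun _ => Classical.arbitrary A, by simp [h₀], by simp, rfl⟩
  have hpar : ∀ v, v ≠ s₀ → ∃ (u : S) (a : A), Nat.find (hex v) = Nat.find (hex u) + 1 ∧
      0 < M.P u a v := by
    intro v hv
    obtain ⟨x, a, hx0, hstep, hxT⟩ := Nat.find_spec (hex v)
    obtain ⟨T, hT⟩ : ∃ T, Nat.find (hex v) = T + 1 := by
      refine Nat.exists_eq_succ_of_ne_zero fun h0 => hv ?_
      rw [h0] at hxT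
      exact hxT.symm.trans (hinit _ hx0)
    rw [hT] at hstep hxT
    have hu : M.ReachableIn T (x T) := ⟨x, a, hx0, fun t ht => hstep t (by omega), rfl⟩
    have hp := hstep T (by omega)
    rw [hxT] at hp
    refine ⟨x T, a T, le_antisymm ?_ ?_, hp⟩
    · -- a shortest path to the predecessor extends to a path to `v`
      obtain ⟨y, b, hy0, hystep, hyT⟩ := Nat.find_spec (hex (x T))
      refine Nat.find_min' _ ?_
      generalize Nat.find (hex (x T)) = m at hystep hyT
      refine ⟨fun t => if t ≤ m then y t else v, fun t => if t < m then b t else a T,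
        by simpa using hy0, fun t ht => ?_, by simp⟩
      rcases Nat.lt_succ_iff_lt_or_eq.1 ht with h | rfl
      · simpa [h, h.le] using hystep t h
      · simpa [hyT] using hp
    · rw [hT]
      exact Nat.succ_le_succ (Nat.find_min' _ hu)
  choose! par nav hdepth hpos using hpar
  refine ⟨⟨fun v => if v = s₀ then s₀ else par v, nav, fun v => Nat.find (hex v), by simp,
    (Nat.find_eq_zero _).2 hroot, fun v hv => by simpa [hv] using hdepth v hv,
    fun v hv => by simpa [hv] using hpos v hv⟩, fun v => ?_⟩
  obtain ⟨T, hT, hr⟩ := hreach v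
  exact (Nat.find_min' _ hr).trans hT

namespace NavTree

variable {M : MDP S A} {s₀ : S} (T : NavTree M s₀)

lemma eq_root_of_depth_eq_zero {v : S} (h : T.depth v = 0) : v = s₀ := by
  by_contra hv
  have := T.depth_eq v hv
  omega

lemma depth_iterate_par (v : S) {k : ℕ} (hk : k ≤ T.depth v) :
    T.depth (T.par^[k] v) + k = T.depth v := by
  induction k with
  | zero => rfl
  | succ k ih =>
    have h := ih (by omega)
    have hne : T.par^[k] v ≠ s₀ := by
      intro h0
      rw [h0, T.depth_root] at h
      omega
    have := T.depth_eq _ hne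
    rw [Function.iterate_succ_apply']
    omega

lemma iterate_par_depth (v : S) : T.par^[T.depth v] v = s₀ :=
  T.eq_root_of_depth_eq_zero (by have := T.depth_iterate_par v le_rfl; omega)

lemma iterate_par_root (k : ℕ) : T.par^[k] s₀ = s₀ := by
  induction k with
  | zero => rfl
  | succ k ih => rw [Function.iterate_succ_apply, T.par_root, ih]

lemma depth_iterate_par_le (v : S) (k : ℕ) : T.depth (T.par^[k] v) ≤ T.depth v := by
  rcases le_total k (T.depth v) with h | h
  · have := T.depth_iterate_par v h
    omega
  · obtain ⟨m, rfl⟩ := Nat.exists_eq_add_of_le' h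
    rw [Function.iterate_add_apply, T.iterate_par_depth, T.iterate_par_root, T.depth_root]
    exact Nat.zero_le _

end NavTree

/-! ### The depth-first lesson plan -/

/-- The position of the teacher in its depth-first traversal of a navigation tree: the states
`done`, where the target action has been taught for good, and the state `cur` whose action is
being taught. -/
structure Plan (S : Type u) where
  done : Finset S
  cur : S

variable {M : MDP S A} {s₀ : S} (T : NavTree M s₀) (π : S → A)

/-- The children of the current state that are not done yet. -/
def Plan.Pending (p : Plan S) (v : S) : Prop :=
  v ≠ s₀ ∧ T.par v = p.cur ∧ v ∉ p.done

open scoped Classical in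
/-- The action to be taught in the current state: the one that leads to a pending child if there is
one, and the target action otherwise. -/
def Plan.lesson (p : Plan S) : A :=
  if h : ∃ v, p.Pending T v then T.nav h.choose else π p.cur

open scoped Classical in
/-- The plan after the current lesson is learned: go down to the pending child if there is one;
otherwise the current state is done, so return to its parent. -/
def Plan.advance (p : Plan S) : Plan S :=
  if h : ∃ v, p.Pending T v then ⟨p.done, h.choose⟩ else ⟨insert p.cur p.done, T.par p.cur⟩

/-- The step `e` is a lesson: it takes place in the current state of the unfinished plan. -/
def Plan.IsLesson (p : Plan S) (e : Step S A) : Prop :=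
  e.state = p.cur ∧ p.cur ∉ p.done

open scoped Classical in
/-- The plan after a history (most recent step first). A lesson is learned once its action has been
played, because the teacher then makes it the unique best one. -/
def planAfter : List (Step S A) → Plan S
  | [] => ⟨∅, s₀⟩
  | e :: h =>
    if (planAfter h).IsLesson e ∧ e.action = (planAfter h).lesson T π then (planAfter h).advance T
    else planAfter h

variable (L : QLearner S A)

open scoped Classical in
/-- The reward for the step `e`: during a lesson it promotes the action to be taught to the unique
best one and demotes every other action to the unique worst one; it changes no rank elsewhere. -/
def Plan.reward (p : Plan S) (Q : S → A → ℝ) (e : Step S A) : ℝ :=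
  if p.IsLesson e then
    if e.action = p.lesson T π then (L.exists_first Q e.state e.action e.next).choose
    else (L.exists_last Q e.state e.action e.next).choose
  else (L.exists_unchanged Q e.state e.action e.next).choose

/-- The Q-table after a history (most recent step first) rewarded according to the plan. -/
def tableAfter (Q₀ : S → A → ℝ) : List (Step S A) → (S → A → ℝ)
  | [] => Q₀
  | e :: h => L.update (tableAfter Q₀ h) e.state e.action
      ((planAfter T π h).reward T π L (tableAfter Q₀ h) e) e.next

/-- The teacher that follows the depth-first lesson plan. -/
def planTeacher (Q₀ : S → A → ℝ) : Teacher S A :=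
  fun h e => (planAfter T π h).reward T π L (tableAfter T π L Q₀ h) e

lemma qTable_planTeacher (Q₀ : S → A → ℝ) (h : List (Step S A)) :
    qTable L (planTeacher T π L Q₀) Q₀ h = tableAfter T π L Q₀ h := by
  induction h with
  | nil => rfl
  | cons e h ih => simp only [qTable, tableAfter, ih, planTeacher]

/-- The action `a` is the unique best one for the action values `q`. -/
def StrictBest (q : A → ℝ) (a : A) : Prop := ∀ b, b ≠ a → q b < q a

section Update

variable {T π L} {p : Plan S} {e : Step S A} {Q : S → A → ℝ}

lemma update_eq_of_state_ne (r : ℝ) {x : S} (hx : x ≠ e.state) :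
    L.update Q e.state e.action r e.next x = Q x :=
  funext fun b => L.update_eq_of_ne _ _ _ _ _ _ _ (by simp [hx])

lemma update_eq_of_action_ne (r : ℝ) {x : S} {b : A} (hb : b ≠ e.action) :
    L.update Q e.state e.action r e.next x b = Q x b :=
  L.update_eq_of_ne _ _ _ _ _ _ _ (by simp [hb])

lemma update_reward_lt_iff (he : ¬ p.IsLesson e) (x : S) (a b : A) :
    L.update Q e.state e.action (p.reward T π L Q e) e.next x a <
      L.update Q e.state e.action (p.reward T π L Q e) e.next x b ↔ Q x a < Q x b := by
  have hs := (L.exists_unchanged Q e.state e.action e.next).choose_spec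
  rw [Plan.reward, if_neg he]
  set r := (L.exists_unchanged Q e.state e.action e.next).choose
  by_cases hx : x = e.state
  · subst hx
    by_cases ha : a = e.action
    · by_cases hb : b = e.action
      · simp [ha, hb]
      · rw [ha, (hs b).2]
    · by_cases hb : b = e.action
      · rw [hb, (hs a).1]
      · rw [update_eq_of_action_ne r ha, update_eq_of_action_ne r hb]
  · rw [update_eq_of_state_ne r hx]

lemma strictBest_update_reward (he : p.IsLesson e) (ha : e.action = p.lesson T π) :
    StrictBest (L.update Q e.state e.action (p.reward T π L Q e) e.next p.cur)
      (p.lesson T π) := by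
  rw [Plan.reward, if_pos he, if_pos ha, ← he.1, ← ha]
  exact (L.exists_first Q e.state e.action e.next).choose_spec

lemma update_reward_lt (he : p.IsLesson e) (ha : e.action ≠ p.lesson T π) {b : A}
    (hb : b ≠ e.action) :
    L.update Q e.state e.action (p.reward T π L Q e) e.next p.cur e.action <
      L.update Q e.state e.action (p.reward T π L Q e) e.next p.cur b := by
  rw [Plan.reward, if_pos he, if_neg ha, ← he.1]
  exact (L.exists_last Q e.state e.action e.next).choose_spec b hb

end Update

/-! ### The invariant of the traversal -/

/-- The invariant of the depth-first traversal: all descendants of a done state are done, the target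
action is the unique best one in every done state, the current state is not done unless everything
is, and the Q-table leads from the root down to the current state. -/
structure Plan.Valid (p : Plan S) (Q : S → A → ℝ) : Prop where
  closed : ∀ v, v ≠ s₀ → T.par v ∈ p.done → v ∈ p.done
  taught : ∀ s ∈ p.done, StrictBest (Q s) (π s)
  active : s₀ ∈ p.done ∨ p.cur ∉ p.done
  guided : ∀ k < T.depth p.cur, StrictBest (Q (T.par^[k + 1] p.cur)) (T.nav (T.par^[k] p.cur))

variable {T π}

/-- Since `done` is closed under taking children, everything is done once the root is. -/
lemma Plan.Valid.induces {p : Plan S} {Q : S → A → ℝ} (hp : p.Valid T π Q) (h₀ : s₀ ∈ p.done) :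
    Induces Q π := by
  have hall : ∀ n v, T.depth v = n → v ∈ p.done := by
    intro n
    induction n with
    | zero => exact fun v hv => T.eq_root_of_depth_eq_zero hv ▸ h₀
    | succ n ih =>
      intro v hv
      have hne : v ≠ s₀ := by
        rintro rfl
        simp [T.depth_root] at hv
      exact hp.closed v hne (ih _ (by have := T.depth_eq v hne; omega))
  exact fun s => hp.taught s (hall _ s rfl)

/-- The invariant survives changes of the Q-table that keep the unique best actions of all states
other than the current one. -/
lemma Plan.Valid.congr {p : Plan S} {Q Q' : S → A → ℝ} (hp : p.Valid T π Q)
    (hQ : ∀ s a, s ≠ p.cur ∨ p.cur ∈ p.done → StrictBest (Q s) a → StrictBest (Q' s) a) :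
    p.Valid T π Q' where
  closed := hp.closed
  taught s hs := by
    refine hQ _ _ ?_ (hp.taught s hs)
    by_cases h : s = p.cur
    · exact Or.inr (h ▸ hs)
    · exact Or.inl h
  active := hp.active
  guided k hk := by
    refine hQ _ _ (Or.inl fun h => ?_) (hp.guided k hk)
    have := T.depth_iterate_par p.cur (k := k + 1) hk
    rw [h] at this
    omega

lemma Plan.Valid.advance {p : Plan S} {Q : S → A → ℝ} (hp : p.Valid T π Q) (hc : p.cur ∉ p.done)
    (hbest : StrictBest (Q p.cur) (p.lesson T π)) : (p.advance T).Valid T π Q := by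
  classical
  unfold Plan.lesson at hbest
  unfold Plan.advance
  split_ifs with h
  · rw [dif_pos h] at hbest
    obtain ⟨hv0, hvp, hvd⟩ := h.choose_spec
    set v := h.choose
    refine ⟨hp.closed, hp.taught, Or.inr hvd, fun k hk => ?_⟩
    have hd := T.depth_eq v hv0
    rw [hvp] at hd
    cases k with
    | zero => simpa [hvp] using hbest
    | succ k =>
      have := hp.guided k (by change k + 1 < T.depth v at hk; omega)
      simp only [Function.iterate_succ_apply, hvp] at this ⊢
      exact this
  · rw [dif_neg h] at hbest
    refine ⟨fun v hv hpar => ?_, fun s hs => ?_, ?_, fun k hk => ?_⟩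
    · rcases Finset.mem_insert.1 hpar with h1 | h1
      · refine Finset.mem_insert_of_mem ?_
        by_contra hvd
        exact h ⟨v, hv, h1, hvd⟩
      · exact Finset.mem_insert_of_mem (hp.closed v hv h1)
    · rcases Finset.mem_insert.1 hs with h1 | h1
      · exact h1 ▸ hbest
      · exact hp.taught s h1
    · by_cases h0 : p.cur = s₀
      · exact Or.inl (by simp [h0])
      · refine Or.inr fun hm => ?_
        rcases Finset.mem_insert.1 hm with h1 | h1
        · have := T.depth_eq _ h0
          simp only at h1
          rw [h1] at this
          omega
        · exact hc (hp.closed _ h0 h1)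
    · by_cases h0 : p.cur = s₀
      · simp [h0, T.par_root, T.depth_root] at hk
      · have := T.depth_eq _ h0
        have := hp.guided (k + 1) (by change k < T.depth (T.par p.cur) at hk; omega)
        simpa only [Function.iterate_succ_apply] using this

lemma valid_planAfter (L : QLearner S A) (Q₀ : S → A → ℝ) (h : List (Step S A)) :
    (planAfter T π h).Valid T π (tableAfter T π L Q₀ h) := by
  induction h with
  | nil =>
    refine ⟨by simp [planAfter], by simp [planAfter], by simp [planAfter], fun k hk => ?_⟩
    simp [planAfter, T.depth_root] at hk
  | cons e h ih =>
    -- a step rewarded by the teacher does no harm outside of a lesson's state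
    have hother : (planAfter T π h).Valid T π (tableAfter T π L Q₀ (e :: h)) := by
      refine ih.congr fun s a hs hb => ?_
      by_cases he : (planAfter T π h).IsLesson e
      · have hne : s ≠ e.state := he.1 ▸ hs.resolve_right he.2
        rw [tableAfter, update_eq_of_state_ne _ hne]
        exact hb
      · exact fun b hba => (update_reward_lt_iff he s b a).2 (hb b hba)
    rw [planAfter]
    split_ifs with hc
    · exact hother.advance hc.1.2 (strictBest_update_reward hc.1 hc.2)
    · exact hother

/-! ### The number of remaining lessons -/

variable (T π)

open scoped Classical in
/-- The number of lessons that remain is at most the number of states that are not done plus the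
number of those that, moreover, are not on the path from the root to the current state. -/
def Plan.lessonsLeft [Fintype S] (p : Plan S) : ℕ :=
  (Finset.univ.filter fun v => v ∉ p.done).card +
    (Finset.univ.filter fun v => v ∉ p.done ∧ ∀ k, T.par^[k] p.cur ≠ v).card

open scoped Classical in
/-- The number of actions that are at least as good as the one to be taught. -/
def Plan.obstacles [Fintype A] (p : Plan S) (Q : S → A → ℝ) : ℕ :=
  (Finset.univ.filter fun b => Q p.cur (p.lesson T π) ≤ Q p.cur b).card

/-- An upper bound on the number of visits to the respective current states that the plan still
needs. -/
def Plan.potential [Fintype S] [Fintype A] (p : Plan S) (Q : S → A → ℝ) : ℕ :=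
  Fintype.card A * p.lessonsLeft T + p.obstacles T π Q

lemma Plan.obstacles_le [Fintype A] (p : Plan S) (Q : S → A → ℝ) :
    p.obstacles T π Q ≤ Fintype.card A :=
  Finset.card_le_univ _

lemma Plan.obstacles_pos [Fintype A] (p : Plan S) (Q : S → A → ℝ) : 0 < p.obstacles T π Q :=
  Finset.card_pos.2 ⟨p.lesson T π, by simp⟩

lemma Plan.lessonsLeft_le [Fintype S] (p : Plan S) : p.lessonsLeft T ≤ 2 * Fintype.card S := by
  rw [two_mul]
  exact add_le_add (Finset.card_le_univ _) (Finset.card_le_univ _)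

lemma Plan.potential_le [Fintype S] [Fintype A] [Nonempty S] (p : Plan S) (Q : S → A → ℝ) :
    p.potential T π Q ≤ 3 * Fintype.card S * Fintype.card A := by
  have h1 := p.lessonsLeft_le T
  have h2 := p.obstacles_le T π Q
  have h3 : 0 < Fintype.card S := Fintype.card_pos
  unfold Plan.potential
  nlinarith [Nat.mul_le_mul_left (Fintype.card A) h1, Nat.mul_le_mul_left (Fintype.card A) h3]

lemma Plan.lessonsLeft_advance_lt [Fintype S] {p : Plan S} (hc : p.cur ∉ p.done) :
    (p.advance T).lessonsLeft T < p.lessonsLeft T := by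
  classical
  unfold Plan.advance
  split_ifs with h
  · -- going down to `v` puts `v` on the path to the current state
    obtain ⟨hv0, hvp, hvd⟩ := h.choose_spec
    set v := h.choose
    unfold Plan.lessonsLeft
    refine Nat.add_lt_add_left (Finset.card_lt_card ?_) _
    refine Finset.ssubset_iff_subset_ne.2 ⟨fun w hw => ?_, fun heq => ?_⟩
    · simp only [Finset.mem_filter, Finset.mem_univ, true_and] at hw ⊢
      refine ⟨hw.1, fun k hk => hw.2 (k + 1) ?_⟩
      rw [Function.iterate_succ_apply, hvp, hk]
    · have hmem : v ∈ Finset.univ.filter fun w => w ∉ p.done ∧ ∀ k, T.par^[k] p.cur ≠ w := by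
        simp only [Finset.mem_filter, Finset.mem_univ, true_and]
        refine ⟨hvd, fun k hk => ?_⟩
        have h1 := T.depth_iterate_par_le p.cur k
        have h2 := T.depth_eq v hv0
        rw [hk] at h1
        rw [hvp] at h2
        omega
      rw [← heq] at hmem
      exact (Finset.mem_filter.1 hmem).2.2 0 rfl
  · -- the state that leaves the path is the one that is done now
    unfold Plan.lessonsLeft
    refine Nat.add_lt_add_of_lt_of_le (Finset.card_lt_card ?_) (Finset.card_le_card ?_)
    · refine Finset.ssubset_iff_subset_ne.2 ⟨fun w hw => ?_, fun heq => ?_⟩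
      · simp only [Finset.mem_filter, Finset.mem_univ, true_and, Finset.mem_insert, not_or] at hw ⊢
        exact hw.2
      · have hmem : p.cur ∈ Finset.univ.filter fun w => w ∉ p.done := by simpa using hc
        rw [← heq] at hmem
        simp at hmem
    · intro w hw
      simp only [Finset.mem_filter, Finset.mem_univ, true_and, Finset.mem_insert, not_or] at hw ⊢
      refine ⟨hw.1.2, fun k hk => ?_⟩
      cases k with
      | zero => exact hw.1.1 hk.symm
      | succ k => exact hw.2 k (by rwa [Function.iterate_succ_apply] at hk)

variable {T π} (Q₀ : S → A → ℝ) {e : Step S A} {h : List (Step S A)}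

/-- A lesson in which the learner acts greedily lowers the potential: either the lesson is learned,
or one more action has fallen behind the one to be taught. -/
lemma potential_lt_of_isLesson [Fintype S] [Fintype A] (he : (planAfter T π h).IsLesson e)
    (hmax : ∀ b, tableAfter T π L Q₀ h e.state b ≤ tableAfter T π L Q₀ h e.state e.action) :
    (planAfter T π (e :: h)).potential T π (tableAfter T π L Q₀ (e :: h)) <
      (planAfter T π h).potential T π (tableAfter T π L Q₀ h) := by
  classical
  set p := planAfter T π h with hp
  set Q := tableAfter T π L Q₀ h with hQ
  by_cases ha : e.action = p.lesson T π
  · have h1 : planAfter T π (e :: h) = p.advance T := by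
      rw [planAfter, if_pos ⟨he, ha⟩]
    rw [h1]
    have h2 := Nat.mul_le_mul_left (Fintype.card A)
      (Nat.succ_le_of_lt (Plan.lessonsLeft_advance_lt T he.2))
    have h3 := (p.advance T).obstacles_le T π (tableAfter T π L Q₀ (e :: h))
    have h4 := p.obstacles_pos T π Q
    unfold Plan.potential
    rw [Nat.mul_succ] at h2
    omega
  · have h1 : planAfter T π (e :: h) = p := by
      rw [planAfter, if_neg fun hn => ha hn.2]
    rw [h1]
    refine Nat.add_lt_add_left (Finset.card_lt_card ?_) _
    have hlesson : tableAfter T π L Q₀ (e :: h) p.cur (p.lesson T π) = Q p.cur (p.lesson T π) :=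
      update_eq_of_action_ne _ (Ne.symm ha)
    have hlt : tableAfter T π L Q₀ (e :: h) p.cur e.action <
        tableAfter T π L Q₀ (e :: h) p.cur (p.lesson T π) := update_reward_lt he ha (Ne.symm ha)
    refine Finset.ssubset_iff_subset_ne.2 ⟨fun b hb => ?_, fun heq => ?_⟩
    · simp only [Finset.mem_filter, Finset.mem_univ, true_and] at hb ⊢
      have hne : b ≠ e.action := by
        rintro rfl
        exact absurd hb (not_le.2 hlt)
      rw [hlesson] at hb
      rwa [tableAfter, update_eq_of_action_ne _ hne] at hb
    · have hmem : e.action ∈ Finset.univ.filter fun b => Q p.cur (p.lesson T π) ≤ Q p.cur b := by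
        simpa [he.1] using hmax (p.lesson T π)
      rw [← heq] at hmem
      exact absurd (Finset.mem_filter.1 hmem).2 (not_le.2 hlt)

lemma planAfter_cons_of_ne (he : e.state ≠ (planAfter T π h).cur) :
    planAfter T π (e :: h) = planAfter T π h := by
  rw [planAfter, if_neg fun hn => he hn.1.1]

lemma potential_eq_of_ne [Fintype S] [Fintype A] (he : e.state ≠ (planAfter T π h).cur) :
    (planAfter T π (e :: h)).potential T π (tableAfter T π L Q₀ (e :: h)) =
      (planAfter T π h).potential T π (tableAfter T π L Q₀ h) := by
  have : tableAfter T π L Q₀ (e :: h) (planAfter T π h).cur =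
      tableAfter T π L Q₀ h (planAfter T π h).cur := update_eq_of_state_ne _ he.symm
  simp only [planAfter_cons_of_ne he, Plan.potential, Plan.obstacles, this]

end

section

/-! ### The steps of a greedy learner -/

lemma tsum_pmf_mul_le {α : Type*} (μ : PMF α) (f : α → ℝ≥0∞) (c : ℝ≥0∞)
    (hf : ∀ x ∈ μ.support, f x ≤ c) : ∑' x, μ x * f x ≤ c := by
  calc ∑' x, μ x * f x ≤ ∑' x, μ x * c := by
        refine ENNReal.tsum_le_tsum fun x => ?_
        by_cases hx : μ x = 0
        · simp [hx]
        · gcongr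
          exact hf x hx
    _ = c := by rw [ENNReal.tsum_mul_right, μ.tsum_coe, one_mul]

lemma QLearner.behavior_isMax [Fintype A] {L : QLearner S A} (hL : L.eps = 0) (Q : S → A → ℝ)
    (s : S) {a : A} (ha : a ∈ (L.behavior Q s).support) (b : A) : Q s b ≤ Q s a := by
  simp only [QLearner.behavior, PMF.mem_support_bind_iff] at ha
  obtain ⟨c, hc, explore, he, ha⟩ := ha
  cases explore with
  | true => simp [coin, hL] at he
  | false =>
    have hac : a = c := by simpa using ha
    exact hac ▸ L.greedy_isMax Q s c hc b

lemma QLearner.behavior_eq_one [Fintype A] {L : QLearner S A} (hL : L.eps = 0) {Q : S → A → ℝ}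
    {s : S} {a : A} (ha : StrictBest (Q s) a) : L.behavior Q s a = 1 := by
  have hsub : ∀ b ∈ (L.behavior Q s).support, b = a := fun b hb => by
    by_contra hne
    exact absurd (L.behavior_isMax hL Q s hb a) (not_le.2 (ha b hne))
  refine (PMF.apply_eq_one_iff _ _).2 (Set.Subset.antisymm hsub ?_)
  obtain ⟨b, hb⟩ := (L.behavior Q s).support_nonempty
  rintro _ rfl
  exact hsub b hb ▸ hb

/-- The current state after a history, if every episode starts in `s₀`. -/
def currentState (M : MDP S A) (s₀ : S) : List (Step S A) → S
  | [] => s₀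
  | e :: h => if M.horizon ∣ (e :: h).length then s₀ else e.next

lemma stateLaw_eq_pure {M : MDP S A} {s₀ : S} (h₀ : M.init = PMF.pure s₀) (h : List (Step S A)) :
    stateLaw M h = PMF.pure (currentState M s₀ h) := by
  cases h with
  | nil => exact h₀
  | cons e h =>
    rw [stateLaw, currentState]
    split_ifs
    · exact h₀
    · rfl

lemma currentState_of_dvd (M : MDP S A) (s₀ : S) {h : List (Step S A)} (hd : M.horizon ∣ h.length) :
    currentState M s₀ h = s₀ := by
  cases h with
  | nil => rfl
  | cons e h => exact if_pos hd

lemma state_and_isMax_of_mem_support [Fintype A] {M : MDP S A} {s₀ : S}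
    (h₀ : M.init = PMF.pure s₀) {L : QLearner S A} (hL : L.eps = 0) (τ : Teacher S A)
    (Q₀ : S → A → ℝ) (h : List (Step S A)) {e : Step S A} (he : e ∈ (stepLaw M L τ Q₀ h).support) :
    e.state = currentState M s₀ h ∧
      ∀ b, qTable L τ Q₀ h e.state b ≤ qTable L τ Q₀ h e.state e.action := by
  rw [stepLaw, stateLaw_eq_pure h₀, PMF.pure_bind, PMF.mem_support_bind_iff] at he
  obtain ⟨a, ha, he⟩ := he
  obtain ⟨s', -, rfl⟩ := (PMF.mem_support_map_iff _ _ _).1 he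
  exact ⟨rfl, L.behavior_isMax hL _ _ ha⟩

lemma le_stepLaw [Fintype A] {M : MDP S A} {s₀ : S}
    (h₀ : M.init = PMF.pure s₀) {L : QLearner S A} (hL : L.eps = 0) (τ : Teacher S A)
    (Q₀ : S → A → ℝ) (h : List (Step S A)) {a : A}
    (ha : StrictBest (qTable L τ Q₀ h (currentState M s₀ h)) a) (s' : S) :
    M.P (currentState M s₀ h) a s' ≤ stepLaw M L τ Q₀ h ⟨currentState M s₀ h, a, s'⟩ := by
  classical
  rw [stepLaw, stateLaw_eq_pure h₀, PMF.pure_bind, PMF.bind_apply]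
  refine le_trans ?_ (ENNReal.le_tsum a)
  rw [L.behavior_eq_one hL ha, one_mul, PMF.map_apply]
  refine le_trans ?_ (ENNReal.le_tsum s')
  simp

/-! ### The minimum transition probability -/

lemma MDP.pMin_le (M : MDP S A) {s : S} {a : A} {s' : S} (h : 0 < M.P s a s') :
    M.pMin ≤ M.P s a s' :=
  iInf_le_of_le s (iInf_le_of_le a (iInf_le_of_le s' (iInf_le_of_le h le_rfl)))

lemma MDP.pMin_le_one [Nonempty S] [Nonempty A] (M : MDP S A) : M.pMin ≤ 1 := by
  obtain ⟨s⟩ := ‹Nonempty S›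
  obtain ⟨a⟩ := ‹Nonempty A›
  obtain ⟨s', hs'⟩ := (M.P s a).support_nonempty
  exact (M.pMin_le (pos_iff_ne_zero.2 hs')).trans ((M.P s a).coe_le_one s')

lemma MDP.pMin_pos [Finite S] [Finite A] [Nonempty S] [Nonempty A] (M : MDP S A) : 0 < M.pMin := by
  unfold MDP.pMin
  obtain ⟨s, hs⟩ := exists_eq_ciInf_of_finite
    (f := fun s => ⨅ (a : A) (s' : S) (_ : 0 < M.P s a s'), M.P s a s')
  obtain ⟨a, ha⟩ := exists_eq_ciInf_of_finite
    (f := fun a => ⨅ (s' : S) (_ : 0 < M.P s a s'), M.P s a s')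
  obtain ⟨s', hs'⟩ := exists_eq_ciInf_of_finite
    (f := fun s' => ⨅ (_ : 0 < M.P s a s'), M.P s a s')
  rw [← hs, ← ha, ← hs']
  by_cases h : 0 < M.P s a s' <;> simp [h]

/-! ### The Lyapunov function -/

variable [Fintype S] [Fintype A] {M : MDP S A} {s₀ : S} (T : NavTree M s₀) (π : S → A)
  (L : QLearner S A) (Q₀ : S → A → ℝ)

lemma mod_succ_of_lt {n m : ℕ} (h : n % m + 1 < m) : (n + 1) % m = n % m + 1 := by
  rw [← Nat.mod_add_mod, Nat.mod_eq_of_lt h]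

/-- The potential of the plan after a history. -/
def potentialAfter (h : List (Step S A)) : ℕ :=
  (planAfter T π h).potential T π (tableAfter T π L Q₀ h)

/-- The learner is on the tree path from the root to the current state of the plan, at the depth
given by the number of steps taken in this episode. -/
def OnPath (h : List (Step S A)) : Prop :=
  h.length % M.horizon ≤ T.depth (planAfter T π h).cur ∧
    T.par^[T.depth (planAfter T π h).cur - h.length % M.horizon] (planAfter T π h).cur =
      currentState M s₀ h

open scoped Classical in
/-- A bound on the remaining teaching time after the history `h`, where `B` bounds the expected cost
of one visit to the current state of the plan. While the learner is on the path, at distance `k`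
from its end, it completes the visit in this episode with probability at least `pMin ^ k`. -/
def lyapunov (B : ℝ≥0∞) (h : List (Step S A)) : ℝ≥0∞ :=
  potentialAfter T π L Q₀ h * B + ((M.horizon - h.length % M.horizon : ℕ) : ℝ≥0∞) -
    if OnPath T π h then
      M.pMin ^ (T.depth (planAfter T π h).cur - h.length % M.horizon) * B else 0

variable {T π L Q₀} {B : ℝ≥0∞}

/-- At the start of an episode the learner is on the path, and its chance to reach the end of the
path pays for the whole episode. -/
lemma lyapunov_le_of_dvd (hB : ∀ v, (M.horizon : ℝ≥0∞) ≤ M.pMin ^ T.depth v * B)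
    {h : List (Step S A)} (hd : M.horizon ∣ h.length) :
    lyapunov T π L Q₀ B h ≤ potentialAfter T π L Q₀ h * B := by
  have hj : h.length % M.horizon = 0 := Nat.mod_eq_zero_of_dvd hd
  have hon : OnPath T π h := by
    rw [OnPath, hj, currentState_of_dvd M s₀ hd, Nat.sub_zero, T.iterate_par_depth]
    exact ⟨Nat.zero_le _, rfl⟩
  rw [lyapunov, if_pos hon, hj, Nat.sub_zero, Nat.sub_zero]
  exact tsub_le_iff_right.2 (by gcongr; exact hB _)

/-- A bound on the new value that does not depend on whether the learner stays on the path. When the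
episode ends, the steps of the next one are paid for by `lyapunov_le_of_dvd`. -/
lemma lyapunov_cons_le (hB : ∀ v, (M.horizon : ℝ≥0∞) ≤ M.pMin ^ T.depth v * B)
    (e : Step S A) (h : List (Step S A)) :
    lyapunov T π L Q₀ B (e :: h) ≤ potentialAfter T π L Q₀ (e :: h) * B +
      ((M.horizon - h.length % M.horizon - 1 : ℕ) : ℝ≥0∞) := by
  by_cases hd : M.horizon ∣ (e :: h).length
  · exact (lyapunov_le_of_dvd hB hd).trans le_self_add
  · have hmod : (e :: h).length % M.horizon = h.length % M.horizon + 1 := by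
      rw [List.length_cons] at hd ⊢
      refine mod_succ_of_lt (lt_of_le_of_ne (Nat.mod_lt _ M.horizon_pos) fun heq => hd ?_)
      rw [Nat.dvd_iff_mod_eq_zero, ← Nat.mod_add_mod, heq, Nat.mod_self]
    refine tsub_le_self.trans ?_
    rw [hmod, Nat.sub_sub]

/-- After a step forward on the path, with `k` steps to go, the Lyapunov function includes the
reduction `pMin ^ k * B`. The potential is positive, so that the truncated subtraction is exact. -/
lemma lyapunov_cons_add_le (hp : M.pMin ≤ 1) {e : Step S A} {h : List (Step S A)}
    {k : ℕ} (hH : T.depth (planAfter T π h).cur < M.horizon)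
    (hk : h.length % M.horizon + (k + 1) = T.depth (planAfter T π h).cur)
    (hplan : planAfter T π (e :: h) = planAfter T π h)
    (hpos : 0 < potentialAfter T π L Q₀ (e :: h))
    (hnext : e.next = T.par^[k] (planAfter T π h).cur) :
    lyapunov T π L Q₀ B (e :: h) + M.pMin ^ k * B ≤ potentialAfter T π L Q₀ (e :: h) * B +
      ((M.horizon - h.length % M.horizon - 1 : ℕ) : ℝ≥0∞) := by
  have hmod : (e :: h).length % M.horizon = h.length % M.horizon + 1 :=
    mod_succ_of_lt (by omega)
  have hon : OnPath T π (e :: h) := by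
    rw [OnPath, hmod, hplan]
    refine ⟨by omega, ?_⟩
    rw [currentState, if_neg (by rw [Nat.dvd_iff_mod_eq_zero, hmod]; omega), hnext]
    congr 2
    omega
  have hsub : T.depth (planAfter T π h).cur - (h.length % M.horizon + 1) = k := by omega
  rw [lyapunov, if_pos hon, hmod, hplan, hsub, Nat.sub_sub, tsub_add_cancel_of_le]
  calc M.pMin ^ k * B ≤ 1 * B := by gcongr; exact pow_le_one₀ zero_le hp
    _ ≤ potentialAfter T π L Q₀ (e :: h) * B := by gcongr; exact_mod_cast hpos
    _ ≤ _ := le_self_add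

/-- The Lyapunov function drops by at least one in expectation. -/
lemma one_add_tsum_lyapunov_le (h₀ : M.init = PMF.pure s₀) (hL : L.eps = 0) (hBtop : B ≠ ∞)
    (hp : M.pMin ≤ 1) (hB : ∀ v, (M.horizon : ℝ≥0∞) ≤ M.pMin ^ T.depth v * B)
    (hH : ∀ v, T.depth v < M.horizon) (h : List (Step S A))
    (hI : ¬ Induces (qTable L (planTeacher T π L Q₀) Q₀ h) π) :
    1 + ∑' e, stepLaw M L (planTeacher T π L Q₀) Q₀ h e * lyapunov T π L Q₀ B (e :: h) ≤
      lyapunov T π L Q₀ B h := by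
  classical
  set μ := stepLaw M L (planTeacher T π L Q₀) Q₀ h
  have hvalid := valid_planAfter (T := T) (π := π) L Q₀ h
  rw [qTable_planTeacher] at hI
  have hcur : (planAfter T π h).cur ∉ (planAfter T π h).done :=
    hvalid.active.resolve_left fun h' => hI (hvalid.induces h')
  have hμ : ∀ e ∈ μ.support, e.state = currentState M s₀ h ∧
      ∀ b, tableAfter T π L Q₀ h e.state b ≤ tableAfter T π L Q₀ h e.state e.action := by
    intro e he
    have := state_and_isMax_of_mem_support h₀ hL _ _ _ he
    rwa [qTable_planTeacher] at this
  have hdrop : ∀ e ∈ μ.support, e.state = (planAfter T π h).cur →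
      potentialAfter T π L Q₀ (e :: h) + 1 ≤ potentialAfter T π L Q₀ h := fun e he hs =>
    potential_lt_of_isLesson L Q₀ ⟨hs, hcur⟩ (hμ e he).2
  have hmono : ∀ e ∈ μ.support, potentialAfter T π L Q₀ (e :: h) ≤ potentialAfter T π L Q₀ h := by
    intro e he
    by_cases hs : e.state = (planAfter T π h).cur
    · exact Nat.le_of_succ_le (hdrop e he hs)
    · exact (potential_eq_of_ne L Q₀ hs).le
  set j := h.length % M.horizon with hj
  have hjH : j < M.horizon := Nat.mod_lt _ M.horizon_pos
  set Φ := potentialAfter T π L Q₀ h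
  set R : ℝ≥0∞ := ((M.horizon - j - 1 : ℕ) : ℝ≥0∞) with hR
  have hR1 : ((M.horizon - j : ℕ) : ℝ≥0∞) = 1 + R := by
    rw [hR, ← Nat.cast_one, ← Nat.cast_add]
    congr 1
    omega
  have hbound : ∀ e ∈ μ.support, lyapunov T π L Q₀ B (e :: h) ≤ Φ * B + R := fun e he =>
    (lyapunov_cons_le hB e h).trans (by gcongr; exact hmono e he)
  rw [lyapunov, ← hj, hR1]
  by_cases hon : OnPath T π h
  · rw [if_pos hon]
    obtain ⟨hjd, hpath⟩ := hon
    rw [← hj] at hjd hpath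
    refine ENNReal.le_sub_of_add_le_right
      (ENNReal.mul_ne_top (ENNReal.pow_ne_top (hp.trans_lt ENNReal.one_lt_top).ne) hBtop) ?_
    suffices hsuff : ∑' e, μ e * lyapunov T π L Q₀ B (e :: h) +
        M.pMin ^ (T.depth (planAfter T π h).cur - j) * B ≤ Φ * B + R by
      calc _ = 1 + (∑' e, μ e * lyapunov T π L Q₀ B (e :: h) +
            M.pMin ^ (T.depth (planAfter T π h).cur - j) * B) := add_assoc _ _ _
        _ ≤ 1 + (Φ * B + R) := by gcongr
        _ = _ := by ring
    obtain ⟨k, hk⟩ := Nat.exists_eq_add_of_le hjd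
    rw [hk, Nat.add_sub_cancel_left] at hpath ⊢
    cases k with
    | zero =>
      -- the learner is in the current state of the plan, where every greedy action is a success
      have hs : ∀ e ∈ μ.support, e.state = (planAfter T π h).cur := fun e he =>
        (hμ e he).1.trans hpath.symm
      obtain ⟨e₁, he₁⟩ := μ.support_nonempty
      obtain ⟨m, hm⟩ : ∃ m, Φ = m + 1 :=
        Nat.exists_eq_add_of_le' (le_trans (Nat.le_add_left 1 _) (hdrop e₁ he₁ (hs e₁ he₁)))
      have h1 : ∑' e, μ e * lyapunov T π L Q₀ B (e :: h) ≤ m * B + R := by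
        refine tsum_pmf_mul_le _ _ _ fun e he => (lyapunov_cons_le hB e h).trans ?_
        have := hdrop e he (hs e he)
        gcongr
        omega
      calc _ ≤ m * B + R + M.pMin ^ 0 * B := by gcongr
        _ = Φ * B + R := by rw [hm]; push_cast; ring
    | succ k =>
      -- the greedy action of the current state leads to the next state `x` of the path
      set x := T.par^[k] (planAfter T π h).cur with hx
      have hparx : T.par x = currentState M s₀ h := by
        rw [← hpath, Function.iterate_succ_apply']
      have hdx : T.depth x + k = T.depth (planAfter T π h).cur :=
        T.depth_iterate_par _ (by omega)
      have hx0 : x ≠ s₀ := by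
        intro hx0
        rw [hx0, T.depth_root] at hdx
        omega
      have hne : ∀ e ∈ μ.support, e.state ≠ (planAfter T π h).cur := by
        intro e he heq
        have h1 := T.depth_eq x hx0
        rw [hparx, ← (hμ e he).1, heq] at h1
        omega
      have hbest : StrictBest (qTable L (planTeacher T π L Q₀) Q₀ h (currentState M s₀ h))
          (T.nav x) := by
        rw [qTable_planTeacher, ← hpath]
        exact hvalid.guided k (by omega)
      have hprob : M.pMin ≤ μ ⟨currentState M s₀ h, T.nav x, x⟩ := by
        refine (M.pMin_le (T.pos x hx0)).trans ?_
        rw [hparx]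
        exact le_stepLaw h₀ hL _ _ _ hbest x
      set e₀ : Step S A := ⟨currentState M s₀ h, T.nav x, x⟩ with he₀
      calc ∑' e, μ e * lyapunov T π L Q₀ B (e :: h) + M.pMin ^ (k + 1) * B
          ≤ ∑' e, μ e * lyapunov T π L Q₀ B (e :: h) + μ e₀ * (M.pMin ^ k * B) := by
            rw [pow_succ', mul_assoc]
            gcongr
        _ = ∑' e, μ e * (lyapunov T π L Q₀ B (e :: h) + if e = e₀ then M.pMin ^ k * B else 0) := by
            simp_rw [mul_add]
            rw [ENNReal.tsum_add]
            congr 1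
            simp [mul_ite]
        _ ≤ Φ * B + R := by
            refine tsum_pmf_mul_le _ _ _ fun e he => ?_
            split_ifs with hee
            · have hpot : potentialAfter T π L Q₀ (e :: h) = Φ := potential_eq_of_ne L Q₀ (hne e he)
              have := lyapunov_cons_add_le (B := B) (T := T) (π := π) (L := L) (Q₀ := Q₀) hp
                (hH _) hk.symm (planAfter_cons_of_ne (hne e he))
                (Nat.lt_of_lt_of_le (Plan.obstacles_pos T π _ _) (Nat.le_add_left _ _))
                (congrArg Step.next hee)
              rwa [hpot] at this
            · rw [add_zero]
              exact hbound e he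
  · rw [if_neg hon, tsub_zero]
    calc _ ≤ 1 + (Φ * B + R) := by gcongr; exact tsum_pmf_mul_le _ _ _ hbound
      _ = _ := by ring

lemma metal_le {M : MDP S A} {s₀ : S} (h₀ : M.init = PMF.pure s₀) {L : QLearner S A}
    (hL : L.eps = 0) {D : ℕ} (hD : M.diameter = D) (hDH : D < M.horizon) (Q₀ : S → A → ℝ)
    (π : S → A) :
    metal M L Q₀ π ≤
      3 * Fintype.card S * Fintype.card A * M.horizon * (1 / M.pMin) ^ D := by
  have : Nonempty S := ⟨s₀⟩
  have : Nonempty A := ⟨π s₀⟩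
  obtain ⟨T, hT⟩ := exists_navTree h₀ hD
  have hp0 : M.pMin ≠ 0 := M.pMin_pos.ne'
  have hp1 := M.pMin_le_one
  have hptop : M.pMin ≠ ∞ := (hp1.trans_lt ENNReal.one_lt_top).ne
  set B : ℝ≥0∞ := M.horizon * (1 / M.pMin) ^ D with hBdef
  have hBtop : B ≠ ∞ := by
    refine ENNReal.mul_ne_top (ENNReal.natCast_ne_top _) (ENNReal.pow_ne_top ?_)
    simpa using hp0
  have hB : ∀ v, (M.horizon : ℝ≥0∞) ≤ M.pMin ^ T.depth v * B := by
    intro v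
    calc (M.horizon : ℝ≥0∞) = M.pMin ^ D * B := by
          rw [hBdef, mul_left_comm, ← mul_pow, one_div, ENNReal.mul_inv_cancel hp0 hptop, one_pow,
            mul_one]
      _ ≤ _ := by gcongr ?_ * _; exact pow_le_pow_of_le_one zero_le hp1 (hT v)
  calc metal M L Q₀ π
      ≤ ∫⁻ ω, teachingTime L (planTeacher T π L Q₀) Q₀ π ω
          ∂trajectoryLaw M L (planTeacher T π L Q₀) Q₀ := iInf_le _ _
    _ ≤ lyapunov T π L Q₀ B [] := lintegral_teachingTime_le _ _ _ _ _ _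
        (one_add_tsum_lyapunov_le h₀ hL hBtop hp1 hB fun v => (hT v).trans_lt hDH)
    _ ≤ potentialAfter T π L Q₀ [] * B := lyapunov_le_of_dvd hB (by simp)
    _ ≤ (3 * Fintype.card S * Fintype.card A : ℕ) * B := by
        gcongr
        exact Plan.potential_le T π _ _
    _ = _ := by rw [hBdef]; push_cast; ring

end

end TeachRL

end

theorem mainTheorem11 :
    ∃ C : ℝ≥0, ∀ (S : Type*) (A : Type*) [Fintype S] [Fintype A] (L : TeachRL.QLearner S A)
      (H D : ℕ) (p : ℝ≥0∞) (F : Set (TeachRL.MDP S A)),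
      L.eps = 0 → D < H →
      (∀ M ∈ F, M.horizon = H ∧ M.diameter = D ∧ M.pMin = p ∧ ∃ s₀ : S, M.init = PMF.pure s₀) →
      TeachRL.teachingDim L F ≤ C * Fintype.card S * Fintype.card A * H * (1 / p) ^ D := by
  refine ⟨3, fun S A _ _ L H D p F hL hDH hF => ?_⟩
  unfold TeachRL.teachingDim
  refine iSup_le fun π => iSup_le fun Q₀ => iSup₂_le fun M hM => ?_
  obtain ⟨rfl, hD, rfl, s₀, h₀⟩ := hF M hM
  exact TeachRL.metal_le h₀ hL hD hDH Q₀ π
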